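/- For an interval $I\subset\mathbb{R}$ of finite length $|I|$ (open, half-open or closed) define the monic integer transfinite diameter $$t_{\mathrm{M}}(I) := \inf_P\ \sup_{x\in I} |P(x)|^{1/\deg P},$$ where the infimum is taken over all non-constant monic polynomials $P$ with integer coefficients. **Theorem.** Every interval $I$ with $|I| = 1$ has $t_{\mathrm{M}}(I)=\tfrac12$; more generally, every interval $I$ with $1\le |I|\le 1.008848$ has $t_{\mathrm{M}}(I)=\tfrac12$. Furthermore, for every real $b$ with $0\le b<1$ there is a closed interval $I$ with $|I|=b$ and $t_{\mathrm{M}}(I)<\tfrac12$, and for every real $b>1.064961507$ there is a closed interval $I$ with $|I|=b$ and $t_{\mathrm{M}}(I)>\tfrac12$. (A one-point set counts as a closed interval of length $0$.) -/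

import Mathlib

open Polynomial MeasureTheory

/-- The normalized supremum `sup_{x ∈ I} |P(x)|^{1 / deg P}` of an integer polynomial `P` on a set
`I` of real numbers, as an element of `[0, ∞]` (so that the supremum always exists). It is used for
non-constant `P` only. -/
noncomputable def normalizedSup (P : ℤ[X]) (I : Set ℝ) : ENNReal :=
  ⨆ x ∈ I, ENNReal.ofReal (|aeval x P| ^ (1 / (P.natDegree : ℝ)))

/-- The monic integer transfinite diameter of a set `I` of real numbers: the infimum of the
normalized suprema on `I` of all non-constant monic polynomials with integer coefficients. -/
noncomputable def monicIntegerTransfiniteDiameter (I : Set ℝ) : ENNReal :=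
  ⨅ (P : ℤ[X]) (_ : P.Monic) (_ : 0 < P.natDegree), normalizedSup P I

/-- `I` is an interval (open, half-open or closed) of finite length `ℓ`. -/
def IsIntervalOfLength (I : Set ℝ) (ℓ : ℝ) : Prop :=
  I.OrdConnected ∧ 0 ≤ ℓ ∧ volume I = ENNReal.ofReal ℓ

/-! Upper bound. Integer translations and reflection preserve `HasHalfBound`, so intervals of length
1.008848 need only be treated for centres in [0, 1/2]. Finitely many explicit monic polynomials with
|P| ≤ 2^(-deg P) cover these (`hasHalfBound_of_center_mem`); each inequality is checked in exact
integer arithmetic by `nonnegTest`.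

Lower bound. If Q is irreducible over ℤ with leading coefficient q > 1, degree d and all roots in
the closure of I, then Res(Q, P) is a nonzero integer for every monic P, which forces the normalized
supremum of P to be at least q^(-1/d) (`le_monicIntegerTransfiniteDiameter`). A closed unit interval
contains a root of some 2x - (2m+1), giving 1/2; the roots of 7x³ - 7x² + 1 span less than
1.064961507, giving 7^(-1/3) > 1/2. For lengths b < 1, P = X on a centred interval suffices. -/

/-! ### Integer polynomials as coefficient lists. -/

/-- The polynomial with the given list of coefficients, constant coefficient first. -/
noncomputable def ofCoeffs : List ℤ → ℤ[X]
  | [] => 0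
  | a :: l => C a + X * ofCoeffs l

/-- The value at `x` of the polynomial with the given list of coefficients. -/
def evalCoeffs (x : ℝ) : List ℤ → ℝ
  | [] => 0
  | a :: l => a + x * evalCoeffs x l

theorem aeval_ofCoeffs (x : ℝ) (l : List ℤ) : aeval x (ofCoeffs l) = evalCoeffs x l := by
  induction l with
  | nil => simp [ofCoeffs, evalCoeffs]
  | cons a l ih => simp [ofCoeffs, evalCoeffs, ih]

theorem degree_ofCoeffs_lt (l : List ℤ) : (ofCoeffs l).degree < l.length := by
  induction l with
  | nil => simp [ofCoeffs]
  | cons a l ih =>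
    refine (degree_add_le _ _).trans_lt (max_lt ?_ ?_)
    · refine degree_C_le.trans_lt ?_
      simp only [List.length_cons]
      exact_mod_cast Nat.succ_pos _
    · rw [mul_comm, degree_mul_X, List.length_cons]
      push_cast
      exact WithBot.add_lt_add_right (by simp) ih

theorem ofCoeffs_append_one (l : List ℤ) :
    ofCoeffs (l ++ [1]) = X ^ l.length + ofCoeffs l := by
  induction l with
  | nil => simp [ofCoeffs]
  | cons a l ih =>
    simp only [List.cons_append, ofCoeffs, ih, List.length_cons]
    ring

theorem monic_ofCoeffs_append_one (l : List ℤ) : (ofCoeffs (l ++ [1])).Monic := by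
  rw [ofCoeffs_append_one]
  exact monic_X_pow_add (degree_ofCoeffs_lt l)

theorem natDegree_ofCoeffs_append_one (l : List ℤ) :
    (ofCoeffs (l ++ [1])).natDegree = l.length := by
  rw [ofCoeffs_append_one, natDegree_add_eq_left_of_degree_lt, natDegree_X_pow]
  rw [degree_X_pow]
  exact degree_ofCoeffs_lt l

/-! ### A computable positivity test on segments. -/

/-- The coefficients of `c + (α + δ X) p`. -/
def mulLinearAdd (α δ c : ℤ) : List ℤ → List ℤ
  | [] => [c]
  | b :: l => (α * b + c) :: mulLinearAdd α δ (δ * b) l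

/-- The coefficients of a positive multiple of `p ((α + δ X) / D)`. -/
def linearSubst (α δ D : ℤ) : List ℤ → List ℤ
  | [] => []
  | a :: l => mulLinearAdd α δ (D ^ l.length * a) (linearSubst α δ D l)

/-- A lower bound on `[0, 1]` of the polynomial with the given coefficients. -/
def lowerBound : List ℤ → ℤ
  | [] => 0
  | a :: l => a + min 0 (lowerBound l)

/-- The coefficients of `c + (1 + X) p`. -/
def mulOneAddXAdd (c : ℤ) : List ℤ → List ℤ
  | [] => [c]
  | b :: l => (b + c) :: mulOneAddXAdd b l

/-- The coefficients of `p (1 + X)`. -/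
def shiftOne : List ℤ → List ℤ
  | [] => []
  | a :: l => mulOneAddXAdd a (shiftOne l)

/-- The coefficients of a positive multiple of `p (X / 2)`. -/
def halve : List ℤ → List ℤ
  | [] => []
  | a :: l => (2 ^ l.length * a) :: halve l

/-- A test, by repeated bisection, for nonnegativity on `[0, 1]`. -/
def nonnegTest : ℕ → List ℤ → Bool
  | 0, l => decide (0 ≤ lowerBound l)
  | k + 1, l => decide (0 ≤ lowerBound l) ||
      (nonnegTest k (halve l) && nonnegTest k (shiftOne (halve l)))

theorem evalCoeffs_mulOneAddXAdd (c : ℤ) (w : ℝ) (l : List ℤ) :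
    evalCoeffs w (mulOneAddXAdd c l) = c + (1 + w) * evalCoeffs w l := by
  induction l generalizing c with
  | nil => simp [mulOneAddXAdd, evalCoeffs]
  | cons b l ih =>
    simp only [mulOneAddXAdd, evalCoeffs, ih]
    push_cast
    ring

theorem evalCoeffs_shiftOne (w : ℝ) (l : List ℤ) :
    evalCoeffs w (shiftOne l) = evalCoeffs (1 + w) l := by
  induction l with
  | nil => simp [shiftOne, evalCoeffs]
  | cons a l ih => simp only [shiftOne, evalCoeffs, evalCoeffs_mulOneAddXAdd, ih]

theorem evalCoeffs_halve (w : ℝ) (l : List ℤ) :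
    2 * evalCoeffs w (halve l) = 2 ^ l.length * evalCoeffs (w / 2) l := by
  induction l with
  | nil => simp [halve, evalCoeffs]
  | cons a l ih =>
    simp only [halve, evalCoeffs, List.length_cons]
    rw [mul_add, mul_left_comm, ih]
    push_cast
    ring

theorem evalCoeffs_halve_nonneg_iff (w : ℝ) (l : List ℤ) :
    0 ≤ evalCoeffs w (halve l) ↔ 0 ≤ evalCoeffs (w / 2) l := by
  rw [← mul_nonneg_iff_of_pos_left (zero_lt_two' ℝ), evalCoeffs_halve,
    mul_nonneg_iff_of_pos_left (by positivity)]

theorem evalCoeffs_mulLinearAdd (α δ c : ℤ) (w : ℝ) (l : List ℤ) :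
    evalCoeffs w (mulLinearAdd α δ c l) = c + (α + δ * w) * evalCoeffs w l := by
  induction l generalizing c with
  | nil => simp [mulLinearAdd, evalCoeffs]
  | cons b l ih =>
    simp only [mulLinearAdd, evalCoeffs, ih]
    push_cast
    ring

/-- The scaling factor is D^(length - 1); the extra D on the left avoids the subtraction. -/
theorem evalCoeffs_linearSubst (α δ D : ℤ) (hD : D ≠ 0) (w : ℝ) (l : List ℤ) :
    D * evalCoeffs w (linearSubst α δ D l) =
      (D : ℝ) ^ l.length * evalCoeffs ((α + δ * w) / D) l := by
  have hD' : (D : ℝ) ≠ 0 := by exact_mod_cast hD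
  induction l with
  | nil => simp [linearSubst, evalCoeffs]
  | cons a l ih =>
    simp only [linearSubst, evalCoeffs, evalCoeffs_mulLinearAdd, List.length_cons]
    have : (D : ℝ) * ((α + δ * w) * evalCoeffs w (linearSubst α δ D l)) =
        (α + δ * w) * ((D : ℝ) ^ l.length * evalCoeffs ((α + δ * w) / D) l) := by
      rw [← ih]; ring
    rw [mul_add, this]
    push_cast
    field_simp
    ring

theorem evalCoeffs_linearSubst_nonneg_iff (α δ D : ℤ) (hD : 0 < D) (w : ℝ) (l : List ℤ) :
    0 ≤ evalCoeffs w (linearSubst α δ D l) ↔ 0 ≤ evalCoeffs ((α + δ * w) / D) l := by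
  have hD' : (0 : ℝ) < D := by exact_mod_cast hD
  rw [← mul_nonneg_iff_of_pos_left hD', evalCoeffs_linearSubst α δ D hD.ne',
    mul_nonneg_iff_of_pos_left (pow_pos hD' _)]

theorem lowerBound_le (l : List ℤ) {w : ℝ} (h0 : 0 ≤ w) (h1 : w ≤ 1) :
    (lowerBound l : ℝ) ≤ evalCoeffs w l := by
  induction l with
  | nil => simp [lowerBound, evalCoeffs]
  | cons a l ih =>
    simp only [lowerBound, evalCoeffs]
    push_cast
    have hm0 : min (0 : ℝ) (lowerBound l) ≤ 0 := min_le_left _ _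
    have hm1 : min (0 : ℝ) (lowerBound l) ≤ lowerBound l := min_le_right _ _
    nlinarith [mul_le_mul_of_nonneg_left (hm1.trans ih) h0]

theorem nonneg_of_nonnegTest (k : ℕ) (l : List ℤ) (h : nonnegTest k l = true) {w : ℝ}
    (h0 : 0 ≤ w) (h1 : w ≤ 1) : 0 ≤ evalCoeffs w l := by
  have key : ∀ l : List ℤ, 0 ≤ lowerBound l → ∀ {w : ℝ}, 0 ≤ w → w ≤ 1 → 0 ≤ evalCoeffs w l :=
    fun l hl w h0 h1 => le_trans (by exact_mod_cast hl) (lowerBound_le l h0 h1)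
  induction k generalizing l w with
  | zero => exact key l (by simpa [nonnegTest] using h) h0 h1
  | succ k ih =>
    simp only [nonnegTest, Bool.or_eq_true, decide_eq_true_eq, Bool.and_eq_true] at h
    rcases h with h | ⟨hl, hr⟩
    · exact key l h h0 h1
    · rcases le_total w (1 / 2) with hw | hw
      · have := ih _ hl (w := 2 * w) (by linarith) (by linarith)
        rwa [evalCoeffs_halve_nonneg_iff, mul_div_cancel_left₀ _ two_ne_zero] at this
      · have := ih _ hr (w := 2 * w - 1) (by linarith) (by linarith)
        rwa [evalCoeffs_shiftOne, evalCoeffs_halve_nonneg_iff, add_sub_cancel,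
          mul_div_cancel_left₀ _ two_ne_zero] at this

/-- The coefficients of `1 + s p`. -/
def oneAddMul (s : ℤ) : List ℤ → List ℤ
  | [] => [1]
  | a :: l => (1 + s * a) :: l.map (s * ·)

theorem evalCoeffs_map_mul (s : ℤ) (x : ℝ) (l : List ℤ) :
    evalCoeffs x (l.map (s * ·)) = s * evalCoeffs x l := by
  induction l with
  | nil => simp [evalCoeffs]
  | cons a l ih =>
    simp only [List.map_cons, evalCoeffs, ih]
    push_cast
    ring

theorem evalCoeffs_oneAddMul (s : ℤ) (x : ℝ) (l : List ℤ) :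
    evalCoeffs x (oneAddMul s l) = 1 + s * evalCoeffs x l := by
  cases l with
  | nil => simp [evalCoeffs, oneAddMul]
  | cons a l =>
    simp only [oneAddMul, evalCoeffs, evalCoeffs_map_mul]
    push_cast
    ring

/-- A test for `|p x| ≤ 2 ^ (-n)` on the segment joining `α / D` and `(α + δ) / D`. -/
def boundTest (k n : ℕ) (l : List ℤ) (α δ D : ℤ) : Bool :=
  nonnegTest k (linearSubst α δ D (oneAddMul (2 ^ n) l)) &&
    nonnegTest k (linearSubst α δ D (oneAddMul (-2 ^ n) l))

theorem abs_le_of_boundTest {k n : ℕ} {l : List ℤ} {α δ D : ℤ} (hD : 0 < D)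
    (h : boundTest k n l α δ D = true) {w : ℝ} (h0 : 0 ≤ w) (h1 : w ≤ 1) :
    |evalCoeffs ((α + δ * w) / D) l| ≤ (1 / 2) ^ n := by
  simp only [boundTest, Bool.and_eq_true] at h
  have ha := nonneg_of_nonnegTest _ _ h.1 h0 h1
  have hb := nonneg_of_nonnegTest _ _ h.2 h0 h1
  rw [evalCoeffs_linearSubst_nonneg_iff _ _ _ hD, evalCoeffs_oneAddMul] at ha hb
  push_cast at ha hb
  have h2 : (0 : ℝ) < 2 ^ n := by positivity
  rw [one_div, inv_pow, ← one_div, le_div_iff₀ h2, ← abs_of_pos h2, ← abs_mul, abs_le]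
  constructor <;> linarith

/-! ### The half bound and its symmetries. -/

/-- Some non-constant monic integer polynomial `P` satisfies `|P| ≤ 2 ^ (- deg P)` on `[l, r]`. -/
def HasHalfBound (l r : ℝ) : Prop :=
  ∃ P : ℤ[X], P.Monic ∧ 0 < P.natDegree ∧
    ∀ x ∈ Set.Icc l r, |aeval x P| ≤ (1 / 2 : ℝ) ^ P.natDegree

theorem HasHalfBound.mono {l r l' r' : ℝ} (h : HasHalfBound l r) (hl : l ≤ l') (hr : r' ≤ r) :
    HasHalfBound l' r' := by
  obtain ⟨P, hP, hd, hb⟩ := h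
  exact ⟨P, hP, hd, fun x hx => hb x ⟨hl.trans hx.1, hx.2.trans hr⟩⟩

theorem HasHalfBound.shift {l r : ℝ} (h : HasHalfBound l r) (k : ℤ) :
    HasHalfBound (l + k) (r + k) := by
  obtain ⟨P, hP, hd, hb⟩ := h
  have hk : (X - C k : ℤ[X]).natDegree = 1 := natDegree_X_sub_C k
  refine ⟨P.comp (X - C k), hP.comp (monic_X_sub_C k) (by rw [hk]; exact one_ne_zero), by
    rwa [natDegree_comp, hk, mul_one],
    fun x hx => ?_⟩
  rw [natDegree_comp, hk, mul_one, aeval_comp]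
  refine hb _ ?_
  simp only [map_sub, aeval_X, aeval_C, Set.mem_Icc, algebraMap_int_eq, Int.coe_castRingHom]
  exact ⟨by linarith [hx.1], by linarith [hx.2]⟩

theorem HasHalfBound.neg {l r : ℝ} (h : HasHalfBound l r) : HasHalfBound (-r) (-l) := by
  obtain ⟨P, hP, hd, hb⟩ := h
  have hnd : (P.comp (-X)).natDegree = P.natDegree := by simp [natDegree_comp]
  have hnd' : (C ((-1) ^ P.natDegree) * P.comp (-X)).natDegree = P.natDegree := by
    rw [natDegree_C_mul (by simp), hnd]
  -- The sign restores monicity in odd degree.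
  refine ⟨C ((-1) ^ P.natDegree) * P.comp (-X), ?_, hnd' ▸ hd, fun x hx => ?_⟩
  · rw [Monic, leadingCoeff_mul, leadingCoeff_C, leadingCoeff_comp (by simp), hP.leadingCoeff]
    simp [← mul_pow]
  · rw [hnd', map_mul, aeval_comp, abs_mul]
    simp only [map_pow, map_neg, map_one, aeval_X, abs_pow, abs_neg, abs_one, one_pow, one_mul]
    exact hb _ ⟨by linarith [hx.2], by linarith [hx.1]⟩

theorem hasHalfBound_of_cover (p : List ℤ) (hp : p ≠ []) {l r : ℝ}
    (h : ∀ x ∈ Set.Icc l r, |evalCoeffs x (p ++ [1])| ≤ (1 / 2) ^ p.length) :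
    HasHalfBound l r := by
  refine ⟨ofCoeffs (p ++ [1]), monic_ofCoeffs_append_one p, ?_, fun x hx => ?_⟩
  · rw [natDegree_ofCoeffs_append_one]
    exact List.length_pos_iff.2 hp
  · rw [natDegree_ofCoeffs_append_one, aeval_ofCoeffs]
    exact h x hx

/-- The split point m/D is meant to be 1/2. For P monic of degree n, 2^n P(1/2) is an odd integer,
so the bound can hold there only with equality. `lowerBound` cannot certify a zero of 1 ± 2^n P
inside a cell, but can at w = 0, where the constant coefficient vanishes; hence both segments start
at m. -/
theorem hasHalfBound_of_boundTest (p : List ℤ) (hp : p ≠ []) (k : ℕ) (u m v D : ℤ) (hD : 0 < D)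
    (hu : u < m) (hv : m < v)
    (h : (boundTest k p.length (p ++ [1]) m (u - m) D &&
      boundTest k p.length (p ++ [1]) m (v - m) D) = true) :
    HasHalfBound (u / D) (v / D) := by
  rw [Bool.and_eq_true] at h
  have hD' : (0 : ℝ) < D := by exact_mod_cast hD
  have hu' : (0 : ℝ) < m - u := by rw [sub_pos]; exact_mod_cast hu
  have hv' : (0 : ℝ) < v - m := by rw [sub_pos]; exact_mod_cast hv
  refine hasHalfBound_of_cover p hp fun x hx => ?_
  have h1 := (div_le_iff₀ hD').1 hx.1
  have h2 := (le_div_iff₀ hD').1 hx.2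
  rcases le_total (x * D) m with hx' | hx'
  · have := abs_le_of_boundTest hD h.1 (w := (m - x * D) / (m - u))
      (div_nonneg (by linarith) hu'.le) ((div_le_one hu').2 (by linarith))
    convert this using 3
    push_cast
    rw [eq_div_iff hD'.ne']
    field_simp
    ring
  · have := abs_le_of_boundTest hD h.2 (w := (x * D - m) / (v - m))
      (div_nonneg (by linarith) hv'.le) ((div_le_one hv').2 (by linarith))
    convert this using 3
    push_cast
    rw [eq_div_iff hD'.ne']
    field_simp
    ring


/-! ### Explicit polynomials for all centres. -/

/-- Here both 1/2 and -1/2 are points of equality. The polynomial x^28 (x⁴ - 4x² + 1) is even, so in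
the variable x² they merge into the single split point 1/4. -/
theorem hasHalfBound_symmetric : HasHalfBound (-0.5225) 0.5225 := by
  refine hasHalfBound_of_cover (List.replicate 28 0 ++ [1, 0, -4, 0]) (by simp) fun x hx => ?_
  have heven : evalCoeffs x (List.replicate 28 0 ++ [1, 0, -4, 0] ++ [1]) =
      evalCoeffs (x ^ 2) (List.replicate 14 0 ++ [1, -4, 1]) := by
    simp only [List.replicate_succ, List.replicate_zero, List.cons_append, List.nil_append,
      evalCoeffs]
    push_cast
    ring
  have key (δ : ℤ) (h : boundTest 9 32 (List.replicate 14 0 ++ [1, -4, 1]) 2500 δ 10000 = true)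
      (w : ℝ) (h0 : 0 ≤ w) (h1 : w ≤ 1) (hw : x ^ 2 = (2500 + δ * w) / 10000) :
      |evalCoeffs (x ^ 2) (List.replicate 14 0 ++ [1, -4, 1])| ≤ (1 / 2) ^ 32 := by
    rw [hw]
    exact_mod_cast abs_le_of_boundTest (by norm_num) h h0 h1
  rw [heven]
  have hx2 : x ^ 2 ≤ 0.5225 ^ 2 := sq_le_sq' hx.1 hx.2
  norm_num at hx2
  rcases le_total (x ^ 2) (1 / 4) with h | h
  -- The two segments in x² run from 1/4 to 0 and from 1/4 to 0.2731 > 0.5225².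
  · exact key (-2500) (by decide +kernel) (1 - 4 * x ^ 2)
      (by linarith) (by linarith [sq_nonneg x]) (by push_cast; ring)
  · exact key 231 (by decide +kernel) ((10000 * x ^ 2 - 2500) / 231)
      (by linarith) (by linarith) (by push_cast; ring)

-- Each polynomial serves a range of centres: it is tested on an interval [u, v]/10⁶ containing all
-- intervals of half-length 0.504424 centred in that range.
set_option maxHeartbeats 1000000 in
theorem hasHalfBound_of_center_mem {c : ℝ} (h0 : 0 ≤ c) (h1 : c ≤ 1 / 2) :
    HasHalfBound (c - 0.504424) (c + 0.504424) := by
  have key (p : List ℤ) (hp : p ≠ []) (u v : ℤ) (hu : u < 500000) (hv : 500000 < v)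
      (h : (boundTest 9 p.length (p ++ [1]) 500000 (u - 500000) 1000000 &&
        boundTest 9 p.length (p ++ [1]) 500000 (v - 500000) 1000000) = true)
      (hl : u / 1000000 + 0.504424 ≤ c) (hr : c ≤ v / 1000000 - 0.504424) :
      HasHalfBound (c - 0.504424) (c + 0.504424) :=
    (hasHalfBound_of_boundTest p hp 9 u 500000 v 1000000 (by norm_num) hu hv h).mono
      (by push_cast; linarith) (by push_cast; linarith)
  rcases le_total c 0.018 with h | h
  · exact hasHalfBound_symmetric.mono (by linarith) (by linarith)
  rcases le_total c 0.051 with h' | h'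
  · exact key
      [0, 0, 0, 0, 0, 0, 0, 0, 0, 0, 0, 1, 2, -15, -18, 75, 40, -125]
      (by simp) (-491424) 555424 (by norm_num) (by norm_num) (by decide +kernel)
      (by push_cast; linarith) (by push_cast; linarith)
  replace h := h'
  rcases le_total c 0.063 with h' | h'
  · exact key
      [0, 0, 0, 0, 0, 0, 0, 0, 1, -1, -5, 6]
      (by simp) (-457424) 567424 (by norm_num) (by norm_num) (by decide +kernel)
      (by push_cast; linarith) (by push_cast; linarith)
  replace h := h'
  rcases le_total c 0.082 with h' | h'
  · exact key
      [0, 0, 0, 0, 0, 0, 0, 0, 0, 0, -1, 1, 5, -7]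
      (by simp) (-444424) 586424 (by norm_num) (by norm_num) (by decide +kernel)
      (by push_cast; linarith) (by push_cast; linarith)
  replace h := h'
  rcases le_total c 0.103 with h' | h'
  · exact key
      [0, 0, 0, 0, 0, 0, 0, 0, 0, 0, 0, 0, -1, 1, 15, -20, -63, 100, 57, -106]
      (by simp) (-425424) 607424 (by norm_num) (by norm_num) (by decide +kernel)
      (by push_cast; linarith) (by push_cast; linarith)
  replace h := h'
  rcases le_total c 0.131 with h' | h'
  · exact key
      [0, 0, 0, 0, 0, 0, 0, 0, 0, 0, 0, -1, 0, 22, -18, -160, 249, 309, -859, 474]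
      (by simp) (-402424) 635424 (by norm_num) (by norm_num) (by decide +kernel)
      (by push_cast; linarith) (by push_cast; linarith)
  replace h := h'
  rcases le_total c 0.142 with h' | h'
  · exact key
      [0, 0, 0, 0, 0, 0, 0, 0, 0, 0, -1, 3, 13, -59, 12, 243, -400, 195]
      (by simp) (-374424) 646424 (by norm_num) (by norm_num) (by decide +kernel)
      (by push_cast; linarith) (by push_cast; linarith)
  replace h := h'
  rcases le_total c 0.162 with h' | h'
  · exact key
      [0, 0, 0, 0, 0, 0, 0, 1, -2, -6, 19, -14]
      (by simp) (-366424) 666424 (by norm_num) (by norm_num) (by decide +kernel)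
      (by push_cast; linarith) (by push_cast; linarith)
  replace h := h'
  rcases le_total c 0.18 with h' | h'
  · exact key
      [0, 0, 0, 0, 0, 0, 0, 0, 0, 0, 1, -4, -8, 53, -36, -141, 256, -125]
      (by simp) (-352424) 684424 (by norm_num) (by norm_num) (by decide +kernel)
      (by push_cast; linarith) (by push_cast; linarith)
  replace h := h'
  rcases le_total c 0.206 with h' | h'
  · exact key
      [0, 0, 0, 0, 0, 0, 0, 0, 0, 0, 1, -8, 2, 138, -385, -141, 2284, -4243, 3377, -1030]
      (by simp) (-324424) 710424 (by norm_num) (by norm_num) (by decide +kernel)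
      (by push_cast; linarith) (by push_cast; linarith)
  replace h := h'
  rcases le_total c 0.225 with h' | h'
  · exact key
      [0, 0, 0, 0, 0, 0, 0, 0, 0, -1, 5, 6, -78, 124, 146, -632, 676, -249]
      (by simp) (-300424) 729424 (by norm_num) (by norm_num) (by decide +kernel)
      (by push_cast; linarith) (by push_cast; linarith)
  replace h := h'
  rcases le_total c 0.248 with h' | h'
  · exact key
      [0, 0, 0, 0, 0, 0, 0, 0, -2, 10, 29, -270, 379, 1210, -5036, 7455, -5216, 1443]
      (by simp) (-283424) 752424 (by norm_num) (by norm_num) (by decide +kernel)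
      (by push_cast; linarith) (by push_cast; linarith)
  replace h := h'
  rcases le_total c 0.275 with h' | h'
  · exact key
      [0, 0, 0, 0, 0, 0, 0, 0, 0, 0, -1, 6, 12, -177, 413, 518, -4612, 10850, -13758, 10160,
      -4125, 713]
      (by simp) (-266424) 779424 (by norm_num) (by norm_num) (by decide +kernel)
      (by push_cast; linarith) (by push_cast; linarith)
  replace h := h'
  rcases le_total c 0.3 with h' | h'
  · exact key
      [0, 0, 0, 0, 0, 0, 0, 0, 0, -1, 6, 18, -233, 549, 978, -8495, 22609, -34202, 32288,
      -18914, 6323, -927]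
      (by simp) (-232424) 804424 (by norm_num) (by norm_num) (by decide +kernel)
      (by push_cast; linarith) (by push_cast; linarith)
  replace h := h'
  -- The polynomial x² - x, with value -1/4 at 1/2.
  · exact key
      [0, -1]
      (by simp) (-205424) 1004424 (by norm_num) (by norm_num) (by decide +kernel)
      (by push_cast; linarith) (by push_cast; linarith)

/-- Subtracting the nearest integer puts the centre in [-1/2, 1/2]; reflection handles the negative
half. -/
theorem hasHalfBound_of_length_eq (a : ℝ) : HasHalfBound a (a + 1.008848) := by
  set k := round (a + 0.504424) with hk
  obtain ⟨hl, hr⟩ := abs_le.1 (abs_sub_round (a + 0.504424))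
  rw [← hk] at hl hr
  rcases le_total 0 (a + 0.504424 - k) with h | h
  · exact ((hasHalfBound_of_center_mem h (by linarith)).shift k).mono (by linarith) (by linarith)
  · exact ((hasHalfBound_of_center_mem (neg_nonneg.2 h) (by linarith)).neg.shift k).mono
      (by linarith) (by linarith)

/-! ### Passage to the diameter; closures. -/

theorem ennreal_half_eq_ofReal : (1 / 2 : ENNReal) = ENNReal.ofReal (1 / 2) := by
  rw [ENNReal.ofReal_div_of_pos two_pos]
  simp

theorem HasHalfBound.monicIntegerTransfiniteDiameter_le {l r : ℝ} (h : HasHalfBound l r)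
    {I : Set ℝ} (hI : I ⊆ Set.Icc l r) : monicIntegerTransfiniteDiameter I ≤ 1 / 2 := by
  obtain ⟨P, hP, hd, hb⟩ := h
  refine iInf_le_of_le P (iInf_le_of_le hP (iInf_le_of_le hd (iSup₂_le fun x hx => ?_)))
  rw [ennreal_half_eq_ofReal]
  refine ENNReal.ofReal_le_ofReal ?_
  calc |aeval x P| ^ (1 / (P.natDegree : ℝ))
      ≤ ((1 / 2 : ℝ) ^ P.natDegree) ^ (1 / (P.natDegree : ℝ)) :=
        Real.rpow_le_rpow (abs_nonneg _) (hb x (hI hx)) (by positivity)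
    _ = 1 / 2 := by
        rw [one_div (P.natDegree : ℝ), Real.pow_rpow_inv_natCast (by norm_num) hd.ne']

theorem normalizedSup_mono (P : ℤ[X]) {I J : Set ℝ} (h : I ⊆ J) :
    normalizedSup P I ≤ normalizedSup P J :=
  biSup_mono h

/-- By continuity. This lets roots of Q sit at endpoints missing from I. -/
theorem normalizedSup_closure (P : ℤ[X]) (I : Set ℝ) :
    normalizedSup P (closure I) = normalizedSup P I := by
  refine le_antisymm (iSup₂_le fun x hx => ?_) (normalizedSup_mono P subset_closure)
  have hc : Continuous fun x : ℝ =>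
      ENNReal.ofReal (|aeval x P| ^ (1 / (P.natDegree : ℝ))) := by
    refine ENNReal.continuous_ofReal.comp
      (Continuous.rpow_const ?_ fun _ => Or.inr (by positivity))
    exact (P.continuous_aeval).abs
  exact closure_minimal (t := {x | ENNReal.ofReal (|aeval x P| ^ (1 / (P.natDegree : ℝ))) ≤
    normalizedSup P I}) (fun y hy => le_iSup₂ (α := ENNReal) (f := fun y (_ : y ∈ I) => _) y hy)
    (isClosed_le hc continuous_const) hx

/-! ### Lower bounds from resultants. -/

theorem abs_prod_map_le_pow_card {ι : Type*} {s : Multiset ι} {f : ι → ℝ} {B : ℝ} (hB : 0 ≤ B)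
    (h : ∀ i ∈ s, |f i| ≤ B) : |(s.map f).prod| ≤ B ^ s.card := by
  induction s using Multiset.induction_on with
  | empty => simp
  | cons a s ih =>
    rw [Multiset.map_cons, Multiset.prod_cons, abs_mul, Multiset.card_cons, pow_succ']
    exact mul_le_mul (h a (Multiset.mem_cons_self a s))
      (ih fun i hi => h i (Multiset.mem_cons_of_mem hi)) (abs_nonneg _) hB

/-- If a non-monic irreducible integer polynomial has all its roots where `|P| ≤ S ^ deg P`, then
comparing the resultant with `1` bounds `S` from below. -/
theorem one_le_leadingCoeff_mul_pow {P Q : ℤ[X]} (hP : P.Monic) (hd : 0 < P.natDegree)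
    (hQ : Irreducible Q) (hlead : 1 < Q.leadingCoeff) (hdeg : Q.natDegree ≠ 0)
    (hsplit : (Q.map (Int.castRingHom ℝ)).Splits) {S : ℝ} (hS : 0 ≤ S)
    (h : ∀ x ∈ (Q.map (Int.castRingHom ℝ)).roots, |aeval x P| ≤ S ^ P.natDegree) :
    1 ≤ Q.leadingCoeff * S ^ Q.natDegree := by
  have hprim : Q.IsPrimitive := hQ.isPrimitive hdeg
  have hcop : IsCoprime (Q.map (Int.castRingHom ℚ)) (P.map (Int.castRingHom ℚ)) := by
    have hirr := (IsPrimitive.Int.irreducible_iff_irreducible_map_cast hprim).1 hQ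
    refine (hirr.coprime_iff_not_dvd).2 fun hdvd => ?_
    -- By Gauss's lemma Q would divide P over ℤ, so its leading coefficient would divide 1.
    obtain ⟨R, rfl⟩ := (IsPrimitive.Int.dvd_iff_map_cast_dvd_map_cast Q P hprim).2 hdvd
    have := hP.leadingCoeff
    rw [leadingCoeff_mul] at this
    rcases Int.eq_one_or_neg_one_of_mul_eq_one this with h | h <;> omega
  have hres : resultant Q P Q.natDegree P.natDegree ≠ 0 := by
    intro h0
    have := resultant_ne_zero _ _ hcop
    rw [natDegree_map_eq_of_injective (Int.cast_injective), natDegree_map_eq_of_injective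
      (Int.cast_injective), resultant_map_map, h0, map_zero] at this
    exact this rfl
  have hev := resultant_eq_prod_eval (Q.map (Int.castRingHom ℝ)) (P.map (Int.castRingHom ℝ))
    P.natDegree natDegree_map_le hsplit
  rw [natDegree_map_eq_of_injective (Int.cast_injective), resultant_map_map,
    leadingCoeff_map_of_injective (Int.cast_injective)] at hev
  have hcard : (Q.map (Int.castRingHom ℝ)).roots.card = Q.natDegree := by
    rw [← hsplit.natDegree_eq_card_roots, natDegree_map_eq_of_injective (Int.cast_injective)]
  have hprod : |((Q.map (Int.castRingHom ℝ)).roots.map (P.map (Int.castRingHom ℝ)).eval).prod| ≤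
      (S ^ P.natDegree) ^ Q.natDegree := by
    rw [← hcard]
    refine abs_prod_map_le_pow_card (pow_nonneg hS _) fun x hx => ?_
    rw [eval_map, ← algebraMap_int_eq, ← aeval_def]
    exact h x hx
  have hone : (1 : ℝ) ≤ |(Int.castRingHom ℝ) (resultant Q P Q.natDegree P.natDegree)| := by
    rw [eq_intCast, ← Int.cast_abs]
    exact_mod_cast Int.one_le_abs hres
  have hl : (0 : ℝ) < Q.leadingCoeff := by exact_mod_cast one_pos.trans hlead
  rw [hev, abs_mul, eq_intCast, abs_of_pos (pow_pos hl _)] at hone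
  have := hone.trans (mul_le_mul_of_nonneg_left hprod (pow_pos hl _).le)
  rw [← pow_mul, mul_comm P.natDegree, pow_mul, ← mul_pow] at this
  exact (one_le_pow_iff_of_nonneg (by positivity) hd.ne').1 this

theorem le_monicIntegerTransfiniteDiameter {Q : ℤ[X]}
    (hQ : Irreducible Q) (hlead : 1 < Q.leadingCoeff) (hdeg : Q.natDegree ≠ 0)
    (hsplit : (Q.map (Int.castRingHom ℝ)).Splits) {I : Set ℝ}
    (hI : ∀ x ∈ (Q.map (Int.castRingHom ℝ)).roots, x ∈ closure I) {s : ℝ}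
    (hs : Q.leadingCoeff * s ^ Q.natDegree ≤ 1) :
    ENNReal.ofReal s ≤ monicIntegerTransfiniteDiameter I := by
  refine le_iInf fun P => le_iInf fun hP => le_iInf fun hd => ?_
  by_contra! hlt
  have htop : normalizedSup P I ≠ ⊤ := hlt.ne_top
  have hlt' : (normalizedSup P I).toReal < s := by
    rwa [ENNReal.lt_ofReal_iff_toReal_lt htop] at hlt
  have h1 := one_le_leadingCoeff_mul_pow hP hd hQ hlead hdeg hsplit
    (S := (normalizedSup P I).toReal) ENNReal.toReal_nonneg fun x hx => by
      have : ENNReal.ofReal (|aeval x P| ^ (1 / (P.natDegree : ℝ))) ≤ normalizedSup P I := by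
        rw [← normalizedSup_closure]
        exact le_iSup₂_of_le x (hI x hx) le_rfl
      rw [ENNReal.ofReal_le_iff_le_toReal htop] at this
      have h2 := pow_le_pow_left₀ (by positivity) this P.natDegree
      rwa [one_div, Real.rpow_inv_natCast_pow (abs_nonneg _) hd.ne'] at h2
  have h2 := pow_lt_pow_left₀ hlt' ENNReal.toReal_nonneg hdeg
  have hl : (0 : ℝ) < Q.leadingCoeff := by exact_mod_cast one_pos.trans hlead
  linarith [mul_lt_mul_of_pos_left h2 hl]

theorem half_le_monicIntegerTransfiniteDiameter {I : Set ℝ} {a : ℝ}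
    (hI : Set.Icc a (a + 1) ⊆ closure I) : 1 / 2 ≤ monicIntegerTransfiniteDiameter I := by
  -- This places m + 1/2, the root of 2x - (2m+1), in [a, a + 1).
  set m := ⌈a - 1 / 2⌉
  have hm0 : a - 1 / 2 ≤ m := Int.le_ceil _
  have hm1 : (m : ℝ) < a - 1 / 2 + 1 := Int.ceil_lt_add_one _
  have hmap : (C 2 * X + C (-(2 * m + 1)) : ℤ[X]).map (Int.castRingHom ℝ) =
      C 2 * (X - C ((m : ℝ) + 1 / 2)) := by
    rw [mul_sub, ← C_mul, sub_eq_add_neg, ← C_neg, Polynomial.map_add, Polynomial.map_mul,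
      Polynomial.map_C, Polynomial.map_C, map_X]
    congr 3
    rw [eq_intCast]
    push_cast
    ring
  rw [ennreal_half_eq_ofReal]
  refine le_monicIntegerTransfiniteDiameter (Q := C 2 * X + C (-(2 * m + 1)))
    (irreducible_C_mul_X_add_C two_ne_zero ?_) ?_ ?_ ?_ ?_ ?_
  · exact IsCoprime.isRelPrime ⟨m + 1, 1, by ring⟩
  · rw [leadingCoeff_linear two_ne_zero]
    norm_num
  · rw [natDegree_linear two_ne_zero]
    norm_num
  · rw [hmap]
    exact (Splits.X_sub_C _).C_mul 2
  · rw [hmap, roots_C_mul _ two_ne_zero, roots_X_sub_C]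
    intro x hx
    rw [Multiset.mem_singleton] at hx
    refine hI ⟨?_, ?_⟩ <;> linarith
  · rw [leadingCoeff_linear two_ne_zero, natDegree_linear two_ne_zero]
    norm_num

/-! ### Intervals of length between 1 and 1.008848, and below 1. -/

theorem IsIntervalOfLength.exists_Ioo_subset {I : Set ℝ} {ℓ : ℝ} (h : IsIntervalOfLength I ℓ)
    (hℓ : 0 < ℓ) : ∃ a, Set.Ioo a (a + ℓ) ⊆ I ∧ I ⊆ Set.Icc a (a + ℓ) := by
  obtain ⟨hc, -, hv⟩ := h
  have hdiff : ∀ x ∈ I, ∀ y ∈ I, y - x ≤ ℓ := fun x hx y hy => by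
    have := measure_mono (μ := volume) (hc.out hx hy)
    rwa [Real.volume_Icc, hv, ENNReal.ofReal_le_ofReal_iff hℓ.le] at this
  have hne : I.Nonempty := by
    rw [Set.nonempty_iff_ne_empty]
    rintro rfl
    rw [measure_empty, eq_comm, ENNReal.ofReal_eq_zero] at hv
    exact hℓ.not_ge hv
  obtain ⟨x₀, hx₀⟩ := hne
  have hbelow : BddBelow I := ⟨x₀ - ℓ, fun x hx => by linarith [hdiff x hx x₀ hx₀]⟩
  have habove : BddAbove I := ⟨x₀ + ℓ, fun x hx => by linarith [hdiff x₀ hx₀ x hx]⟩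
  have hout : I ⊆ Set.Icc (sInf I) (sSup I) :=
    fun x hx => ⟨csInf_le hbelow hx, le_csSup habove hx⟩
  have hin : Set.Ioo (sInf I) (sSup I) ⊆ I := fun x hx => by
    obtain ⟨y, hy, hyx⟩ := exists_lt_of_csInf_lt ⟨x₀, hx₀⟩ hx.1
    obtain ⟨z, hz, hxz⟩ := exists_lt_of_lt_csSup ⟨x₀, hx₀⟩ hx.2
    exact hc.out hy hz ⟨hyx.le, hxz.le⟩
  have hlen : sSup I = sInf I + ℓ := by
    have hle : sInf I ≤ sSup I := (csInf_le hbelow hx₀).trans (le_csSup habove hx₀)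
    have h1 := measure_mono (μ := volume) hin
    have h2 := measure_mono (μ := volume) hout
    rw [Real.volume_Ioo, hv, ENNReal.ofReal_le_ofReal_iff hℓ.le] at h1
    rw [Real.volume_Icc, hv, ENNReal.ofReal_le_ofReal_iff (by linarith)] at h2
    linarith
  exact ⟨sInf I, hlen ▸ hin, hlen ▸ hout⟩

theorem IsIntervalOfLength.monicIntegerTransfiniteDiameter_eq {I : Set ℝ} {ℓ : ℝ}
    (h : IsIntervalOfLength I ℓ) (h1 : 1 ≤ ℓ) (h2 : ℓ ≤ 1.008848) :
    monicIntegerTransfiniteDiameter I = 1 / 2 := by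
  obtain ⟨a, hin, hout⟩ := h.exists_Ioo_subset (by linarith)
  refine le_antisymm ?_ ?_
  · exact (hasHalfBound_of_length_eq a).monicIntegerTransfiniteDiameter_le
      (hout.trans (Set.Icc_subset_Icc_right (by linarith)))
  · refine half_le_monicIntegerTransfiniteDiameter (a := a) ?_
    refine (Set.Icc_subset_Icc_right (by linarith)).trans
      ((closure_Ioo (by linarith)).symm.subset.trans (closure_mono hin))

theorem monicIntegerTransfiniteDiameter_Icc_lt_half {b : ℝ} (h1 : b < 1) :
    monicIntegerTransfiniteDiameter (Set.Icc (-(b / 2)) (-(b / 2) + b)) < 1 / 2 := by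
  refine lt_of_le_of_lt (b := ENNReal.ofReal (b / 2)) ?_ ?_
  · refine iInf_le_of_le X (iInf_le_of_le monic_X (iInf_le_of_le (by simp)
      (iSup₂_le fun x hx => ENNReal.ofReal_le_ofReal ?_)))
    simpa using abs_le.2 ⟨hx.1, by linarith [hx.2]⟩
  · rw [ennreal_half_eq_ofReal]
    exact (ENNReal.ofReal_lt_ofReal_iff (by norm_num)).2 (by linarith)

/-! ### The cubic 7x³ - 7x² + 1 and long intervals. -/

theorem natDegree_cubic_eq : (C 7 * X ^ 3 + C (-7) * X ^ 2 + C 0 * X + C 1 : ℤ[X]).natDegree = 3 :=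
  natDegree_cubic (by norm_num)

theorem leadingCoeff_cubic_eq :
    (C 7 * X ^ 3 + C (-7) * X ^ 2 + C 0 * X + C 1 : ℤ[X]).leadingCoeff = 7 :=
  leadingCoeff_cubic (by norm_num)

theorem irreducible_cubic : Irreducible (C 7 * X ^ 3 + C (-7) * X ^ 2 + C 0 * X + C 1 : ℤ[X]) := by
  have hprim : (C 7 * X ^ 3 + C (-7) * X ^ 2 + C 0 * X + C 1 : ℤ[X]).IsPrimitive := by
    intro r hr
    rw [C_dvd_iff_dvd_coeff] at hr
    refine isUnit_of_dvd_one ?_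
    simpa [coeff_X] using hr 0
  have hdeg : ((C 7 * X ^ 3 + C (-7) * X ^ 2 + C 0 * X + C 1 : ℤ[X]).map
      (Int.castRingHom ℚ)).natDegree = 3 := by
    rw [natDegree_map_eq_of_injective Int.cast_injective, natDegree_cubic_eq]
  rw [IsPrimitive.Int.irreducible_iff_irreducible_map_cast hprim]
  refine irreducible_of_degree_le_three_of_not_isRoot (by rw [hdeg]; simp) fun r hr => ?_
  have hr' : 7 * r ^ 3 - 7 * r ^ 2 + 1 = 0 := by
    simp only [IsRoot, Polynomial.map_add, Polynomial.map_mul, Polynomial.map_C,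
      Polynomial.map_pow, map_X, eval_add, eval_mul, eval_C, eval_pow, eval_X] at hr
    norm_num at hr
    linear_combination hr
  have hr0 : r ≠ 0 := by rintro rfl; norm_num at hr'
  have hroot : (r⁻¹) ^ 3 - 7 * r⁻¹ + 7 = 0 := by
    field_simp
    linear_combination hr'
  -- The reversed cubic is monic, so 1/r would be an integer k; but k³ - 7k + 7 is always odd.
  have hint : IsIntegral ℤ r⁻¹ := by
    refine ⟨X ^ 3 - C 7 * X + C 7, by monicity!, ?_⟩
    simpa using hroot
  obtain ⟨k, hk⟩ := IsIntegrallyClosed.isIntegral_iff.1 hint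
  rw [← hk, eq_intCast] at hroot
  have hk0 : k ^ 3 - 7 * k + 7 = 0 := by exact_mod_cast hroot
  obtain ⟨m, rfl | rfl⟩ := k.even_or_odd'
  · have : 2 * (4 * m ^ 3 - 7 * m) = -7 := by linear_combination hk0
    omega
  · have : 2 * (4 * m ^ 3 + 6 * m ^ 2 - 4 * m) = -1 := by linear_combination hk0
    omega

theorem half_lt_monicIntegerTransfiniteDiameter_Icc {b : ℝ} (hb : 1.064961507 < b) :
    1 / 2 < monicIntegerTransfiniteDiameter (Set.Icc (-0.3279852777) (-0.3279852777 + b)) := by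
  -- Sign changes locate three real roots; the outer bounds differ by exactly 1.064961507.
  set f : ℝ → ℝ := fun x => 7 * x ^ 3 - 7 * x ^ 2 + 1
  have hf : Continuous f := by fun_prop
  obtain ⟨x, hx, hfx⟩ : (0 : ℝ) ∈ f '' Set.Icc (-0.3279852777) 0 :=
    intermediate_value_Icc (by norm_num) hf.continuousOn (by norm_num [f])
  obtain ⟨y, hy, hfy⟩ : (0 : ℝ) ∈ f '' Set.Icc 0.5 0.6 :=
    intermediate_value_Icc' (by norm_num) hf.continuousOn (by norm_num [f])
  obtain ⟨z, hz, hfz⟩ : (0 : ℝ) ∈ f '' Set.Icc 0.7 0.7369762293 :=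
    intermediate_value_Icc (by norm_num) hf.continuousOn (by norm_num [f])
  obtain ⟨hx0, hx1⟩ := hx
  obtain ⟨hy0, hy1⟩ := hy
  obtain ⟨hz0, hz1⟩ := hz
  simp only [f] at hfx hfy hfz
  -- Dividing differences of the root equations by differences of the roots yields Vieta's
  -- relations, hence the splitting.
  have hxy : 7 * (x ^ 2 + x * y + y ^ 2) - 7 * (x + y) = 0 :=
    (mul_eq_zero.1 (by linear_combination hfx - hfy :
      (x - y) * (7 * (x ^ 2 + x * y + y ^ 2) - 7 * (x + y)) = 0)).resolve_left (by
        intro h; linarith)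
  have hxz : 7 * (x ^ 2 + x * z + z ^ 2) - 7 * (x + z) = 0 :=
    (mul_eq_zero.1 (by linear_combination hfx - hfz :
      (x - z) * (7 * (x ^ 2 + x * z + z ^ 2) - 7 * (x + z)) = 0)).resolve_left (by
        intro h; linarith)
  have hsum : x + y + z = 1 := by
    have := (mul_eq_zero.1 (by linear_combination (hxy - hxz) / 7 :
      (y - z) * (x + y + z - 1) = 0)).resolve_left (by intro h; linarith)
    linarith
  have hpair : x * y + x * z + y * z = 0 := by
    obtain rfl : z = 1 - x - y := by linarith
    linear_combination -hxy / 7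
  have hprod : x * y * z = -1 / 7 := by
    linear_combination hfx / 7 - x ^ 2 * hsum + x * hpair
  have hmap : (C 7 * X ^ 3 + C (-7) * X ^ 2 + C 0 * X + C 1 : ℤ[X]).map (Int.castRingHom ℝ) =
      C 7 * ((X - C x) * ((X - C y) * (X - C z))) := by
    have e : (C 7 * ((X - C x) * ((X - C y) * (X - C z))) : ℝ[X]) =
        C 7 * X ^ 3 + C (-7 * (x + y + z)) * X ^ 2 + C (7 * (x * y + x * z + y * z)) * X +
          C (-7 * (x * y * z)) := by
      simp only [C_mul, C_add, C_neg]
      ring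
    rw [e, hsum, hpair, hprod]
    simp only [Polynomial.map_add, Polynomial.map_mul, Polynomial.map_C, Polynomial.map_pow, map_X]
    norm_num
  -- 0.52 is a rational between 1/2 and 7^(-1/3): 7 · 0.52³ < 1.
  refine lt_of_lt_of_le (b := ENNReal.ofReal 0.52) ?_
    (le_monicIntegerTransfiniteDiameter irreducible_cubic ?_ ?_ ?_ ?_ ?_)
  · rw [ennreal_half_eq_ofReal]
    exact (ENNReal.ofReal_lt_ofReal_iff (by norm_num)).2 (by norm_num)
  · rw [leadingCoeff_cubic_eq]; norm_num
  · rw [natDegree_cubic_eq]; norm_num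
  · rw [hmap]
    exact ((Splits.X_sub_C _).mul ((Splits.X_sub_C _).mul (Splits.X_sub_C _))).C_mul 7
  · intro w hw
    rw [hmap, mem_roots'] at hw
    have hw' := hw.2
    simp only [IsRoot, eval_mul, eval_C, eval_sub, eval_X, mul_eq_zero, sub_eq_zero] at hw'
    refine subset_closure ?_
    norm_num at hw'
    rcases hw' with rfl | rfl | rfl <;> constructor <;> linarith
  · rw [leadingCoeff_cubic_eq, natDegree_cubic_eq]; norm_num

theorem theorem1p1 :
    (∀ I : Set ℝ, IsIntervalOfLength I 1 → monicIntegerTransfiniteDiameter I = 1 / 2) ∧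
    (∀ (I : Set ℝ) (ℓ : ℝ), IsIntervalOfLength I ℓ → 1 ≤ ℓ → ℓ ≤ 1.008848 →
      monicIntegerTransfiniteDiameter I = 1 / 2) ∧
    (∀ b : ℝ, 0 ≤ b → b < 1 →
      ∃ a : ℝ, monicIntegerTransfiniteDiameter (Set.Icc a (a + b)) < 1 / 2) ∧
    (∀ b : ℝ, 1.064961507 < b →
      ∃ a : ℝ, 1 / 2 < monicIntegerTransfiniteDiameter (Set.Icc a (a + b))) :=
  ⟨fun _ h => h.monicIntegerTransfiniteDiameter_eq le_rfl (by norm_num),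
    fun _ _ h h1 h2 => h.monicIntegerTransfiniteDiameter_eq h1 h2,
    fun _ _ h1 => ⟨_, monicIntegerTransfiniteDiameter_Icc_lt_half h1⟩,
    fun _ hb => ⟨_, half_lt_monicIntegerTransfiniteDiameter_Icc hb⟩⟩
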